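/- Let $m,\ell,n\ge 0$ be integers with $\ell>2n$, and let $r$ be an integer with $r\ge 2$ or $r=\infty$. Let $X$ be a compact $C^r$ manifold (without boundary, Hausdorff, with a countable basis) of dimension $n$, let $V$ be an open subset of $\mathbb{R}^m$, let $f$ be a $C^r$ embedding of $X$ into $V$ (a $C^r$ immersion that is a homeomorphism onto its image), and let $g:V\to\mathbb{R}^\ell$ be a $C^r$ mapping. Let $\mathcal{L}(\mathbb{R}^m,\mathbb{R}^\ell)$ be the space of all linear mappings $\mathbb{R}^m\to\mathbb{R}^\ell$, identified through representing matrices with the Euclidean space $(\mathbb{R}^m)^\ell$, and set $$\Sigma=\{\pi\in\mathcal{L}(\mathbb{R}^m,\mathbb{R}^\ell) \mid (g+\pi)\circ f:X\to\mathbb{R}^\ell \text{ is not a } C^r \text{ embedding}\}.$$ Then, for every real number $s>m\ell+2n-\ell$, the set $\Sigma$ has $s$-dimensional Hausdorff measure zero in $\mathcal{L}(\mathbb{R}^m,\mathbb{R}^\ell)$. -/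

import Mathlib

open scoped Manifold ContDiff

/-- A `C^r` embedding (`r ≥ 1`) of a `C^r` manifold `X` of dimension `n` into `ℝ^k`: a `C^r` map
which is an immersion (its differential is injective at every point) and a homeomorphism onto its
image. -/
structure IsCrEmbedding (n : ℕ) {k : ℕ} {X : Type*} [TopologicalSpace X]
    [ChartedSpace (EuclideanSpace ℝ (Fin n)) X] (r : ℕ∞)
    (h : X → EuclideanSpace ℝ (Fin k)) : Prop where
  contMDiff : ContMDiff (𝓡 n) (𝓡 k) r h
  injective_mfderiv : ∀ x : X, Function.Injective (mfderiv (𝓡 n) (𝓡 k) h x)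
  isEmbedding : Topology.IsEmbedding h

/-- The identification of the space of linear maps `ℝ^m → ℝ^l` with the Euclidean space `(ℝ^m)^l`:
a linear map is sent to the family of the entries of its representing matrix. -/
noncomputable def matrixEntries {m l : ℕ}
    (p : EuclideanSpace ℝ (Fin m) →ₗ[ℝ] EuclideanSpace ℝ (Fin l)) :
    EuclideanSpace ℝ (Fin l × Fin m) :=
  WithLp.toLp 2 fun ij => p (EuclideanSpace.single ij.2 1) ij.1

/-- A set of linear maps `ℝ^m → ℝ^l` has `s`-dimensional Hausdorff measure zero, the space of linear
maps being regarded as the Euclidean space `(ℝ^m)^l`. -/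
def HasHausdorffMeasureZero {m l : ℕ} (s : ℝ)
    (S : Set (EuclideanSpace ℝ (Fin m) →ₗ[ℝ] EuclideanSpace ℝ (Fin l))) : Prop :=
  MeasureTheory.Measure.hausdorffMeasure s (matrixEntries '' S) = 0

/-! Since `X` is compact, a perturbed map that is not an embedding fails to be injective or to be
immersive. Either failure reads `B z + p (A z) = 0` with `A z ≠ 0`, where `z` ranges over an open
set of dimension `2n`: pairs of points, with `A` a difference of values of `f`, or tangent vectors,
with `A` the differential of `f`. For fixed `z` these are `l` independent affine conditions on `p`,
so the bad set has Hausdorff dimension at most `2n + l(m - 1)`. `dimH_setOf_mulVec_eq_le_of_coord`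
makes this count rigorous by covering the bad matrices with a `C^1` image of an open set of that
dimension. -/

theorem dimH_image_le_finrank_of_contDiffOn {E F : Type*}
    [NormedAddCommGroup E] [NormedSpace ℝ E] [FiniteDimensional ℝ E]
    [NormedAddCommGroup F] [NormedSpace ℝ F] {φ : E → F} {U : Set E} (hU : IsOpen U)
    (hφ : ContDiffOn ℝ 1 φ U) : dimH (φ '' U) ≤ Module.finrank ℝ E := by
  calc dimH (φ '' U) ≤ dimH U := by
        refine dimH_image_le_of_locally_lipschitzOn fun x hx => ?_
        obtain ⟨K, t, ht, hK⟩ :=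
          (hφ.contDiffAt (hU.mem_nhds hx)).exists_lipschitzOnWith
        exact ⟨K, t, mem_nhdsWithin_of_mem_nhds ht, hK⟩
    _ ≤ dimH (Set.univ : Set E) := dimH_mono (Set.subset_univ U)
    _ = Module.finrank ℝ E := Real.dimH_univ_eq_finrank E

/-- Matrices sending some `A z` with nonzero `j`-th coordinate to `-B z`. -/
theorem dimH_setOf_mulVec_eq_le_of_coord {E : Type*}
    [NormedAddCommGroup E] [NormedSpace ℝ E] [FiniteDimensional ℝ E] {m l : ℕ} {U : Set E}
    (hU : IsOpen U) {A : E → EuclideanSpace ℝ (Fin m)} {B : E → EuclideanSpace ℝ (Fin l)}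
    (hA : ContDiffOn ℝ 1 A U) (hB : ContDiffOn ℝ 1 B U) (j : Fin m) :
    dimH {q : EuclideanSpace ℝ (Fin l × Fin m) |
        ∃ z ∈ U, A z j ≠ 0 ∧ ∀ i, B z i + ∑ k, q (i, k) * A z k = 0} ≤
      (Module.finrank ℝ E + l * (m - 1) : ℕ) := by
  -- The entries outside column `j` are free; each row equation is then solved for its entry in
  -- column `j`, dividing by `A z j`.
  let Ψ : E × (Fin l × {k : Fin m // k ≠ j} → ℝ) → EuclideanSpace ℝ (Fin l × Fin m) :=
    fun w => WithLp.toLp 2 fun ik =>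
      if h : ik.2 ≠ j then w.2 (ik.1, ⟨ik.2, h⟩)
      else -(B w.1 ik.1 + ∑ k : {k : Fin m // k ≠ j}, w.2 (ik.1, k) * A w.1 k) / A w.1 j
  have hAi (k : Fin m) : ContDiffOn ℝ 1 (fun z => A z k) U := (contDiffOn_euclidean.1 hA) k
  have hBi (i : Fin l) : ContDiffOn ℝ 1 (fun z => B z i) U := (contDiffOn_euclidean.1 hB) i
  let W : Set E := {z ∈ U | A z j ≠ 0}
  have hW : IsOpen W := (hAi j).continuousOn.isOpen_inter_preimage hU isOpen_ne
  have hΨ : ContDiffOn ℝ 1 Ψ (W ×ˢ Set.univ) := by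
    refine contDiffOn_euclidean.2 fun ik => ?_
    have hfst : ContDiffOn ℝ 1 (Prod.fst : E × (Fin l × {k : Fin m // k ≠ j} → ℝ) → E)
      (W ×ˢ Set.univ) := contDiff_fst.contDiffOn
    have hmaps : Set.MapsTo (Prod.fst : E × (Fin l × {k : Fin m // k ≠ j} → ℝ) → E)
      (W ×ˢ Set.univ) U := fun w hw => hw.1.1
    have hc (a : Fin l × {k : Fin m // k ≠ j}) : ContDiffOn ℝ 1
        (fun w : E × (Fin l × {k : Fin m // k ≠ j} → ℝ) => w.2 a) (W ×ˢ Set.univ) :=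
      ((contDiff_apply ℝ ℝ a).comp contDiff_snd).contDiffOn
    by_cases h : ik.2 ≠ j
    · simpa [Ψ, h] using hc (ik.1, ⟨ik.2, h⟩)
    · simp only [Ψ, h, dite_false]
      refine ContDiffOn.div (ContDiffOn.neg (ContDiffOn.add ((hBi _).comp hfst hmaps)
        (ContDiffOn.sum fun k _ => (hc _).mul ((hAi _).comp hfst hmaps))))
        ((hAi _).comp hfst hmaps) fun w hw => hw.1.2
  have hrank : Module.finrank ℝ (E × (Fin l × {k : Fin m // k ≠ j} → ℝ)) =
      Module.finrank ℝ E + l * (m - 1) := by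
    simp [Module.finrank_prod, Fintype.card_subtype_compl]
  rw [← hrank]
  refine (dimH_mono ?_).trans
    (dimH_image_le_finrank_of_contDiffOn (hW.prod isOpen_univ) hΨ)
  rintro q ⟨z, hzU, hzj, hz⟩
  refine ⟨(z, fun ik => q (ik.1, ik.2)), ⟨⟨hzU, hzj⟩, trivial⟩, ?_⟩
  ext ⟨i, k⟩
  by_cases h : k = j
  · subst h
    simp only [Ψ, ne_eq, not_true_eq_false, dite_false]
    rw [div_eq_iff hzj]
    have h2 := Fintype.sum_eq_add_sum_subtype_ne (fun k' => q (i, k') * A z k') k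
    have h3 := hz i
    rw [h2] at h3
    simp only [ne_eq] at h3 ⊢
    linarith
  · simp [Ψ, h]

theorem dimH_setOf_mulVec_eq_le {E : Type*}
    [NormedAddCommGroup E] [NormedSpace ℝ E] [FiniteDimensional ℝ E] {m l : ℕ} {U : Set E}
    (hU : IsOpen U) {A : E → EuclideanSpace ℝ (Fin m)} {B : E → EuclideanSpace ℝ (Fin l)}
    (hA : ContDiffOn ℝ 1 A U) (hB : ContDiffOn ℝ 1 B U) :
    dimH {q : EuclideanSpace ℝ (Fin l × Fin m) |
        ∃ z ∈ U, A z ≠ 0 ∧ ∀ i, B z i + ∑ k, q (i, k) * A z k = 0} ≤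
      (Module.finrank ℝ E + l * (m - 1) : ℕ) := by
  refine (dimH_mono (t := ⋃ j, {q : EuclideanSpace ℝ (Fin l × Fin m) |
        ∃ z ∈ U, A z j ≠ 0 ∧ ∀ i, B z i + ∑ k, q (i, k) * A z k = 0}) ?_).trans ?_
  · rintro q ⟨z, hzU, hz0, hz⟩
    obtain ⟨j, hj⟩ : ∃ j, A z j ≠ 0 := by
      by_contra! h
      exact hz0 (by ext j; simpa using h j)
    exact Set.mem_iUnion.2 ⟨j, z, hzU, hj, hz⟩
  · rw [dimH_iUnion]
    exact iSup_le fun j => dimH_setOf_mulVec_eq_le_of_coord hU hA hB j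

theorem linearMap_apply_eq_sum_matrixEntries {m l : ℕ}
    (p : EuclideanSpace ℝ (Fin m) →ₗ[ℝ] EuclideanSpace ℝ (Fin l))
    (u : EuclideanSpace ℝ (Fin m)) (i : Fin l) :
    p u i = ∑ k, matrixEntries p (i, k) * u k := by
  conv_lhs => rw [← (EuclideanSpace.basisFun (Fin m) ℝ).sum_repr u]
  simp [matrixEntries, mul_comm]

theorem dimH_matrixEntries_image_le {E : Type*}
    [NormedAddCommGroup E] [NormedSpace ℝ E] [FiniteDimensional ℝ E] {m l : ℕ} {U : Set E}
    (hU : IsOpen U) {A : E → EuclideanSpace ℝ (Fin m)} {B : E → EuclideanSpace ℝ (Fin l)}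
    (hA : ContDiffOn ℝ 1 A U) (hB : ContDiffOn ℝ 1 B U) :
    dimH (matrixEntries '' {p | ∃ z ∈ U, A z ≠ 0 ∧ B z + p (A z) = 0}) ≤
      (Module.finrank ℝ E + l * (m - 1) : ℕ) := by
  refine (dimH_mono ?_).trans (dimH_setOf_mulVec_eq_le hU hA hB)
  rintro _ ⟨p, ⟨z, hzU, hz0, hz⟩, rfl⟩
  refine ⟨z, hzU, hz0, fun i => ?_⟩
  rw [← linearMap_apply_eq_sum_matrixEntries]
  simpa using congrArg (fun v : EuclideanSpace ℝ (Fin l) => v i) hz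

/-- The chart is centred at `a` rather than at `x`, so that finitely many charts serve all points.
-/
theorem mfderiv_apply_eq_fderiv_comp_extChartAt_symm {n k : ℕ}
    {X : Type*} [TopologicalSpace X] [ChartedSpace (EuclideanSpace ℝ (Fin n)) X]
    [IsManifold (𝓡 n) 1 X] {h : X → EuclideanSpace ℝ (Fin k)} (hh : ContMDiff (𝓡 n) (𝓡 k) 1 h)
    {a x : X} (hx : x ∈ (chartAt (EuclideanSpace ℝ (Fin n)) a).source)
    (v : TangentSpace (𝓡 n) x) :
    mfderiv (𝓡 n) (𝓡 k) h x v =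
      fderiv ℝ (h ∘ (extChartAt (𝓡 n) a).symm) (extChartAt (𝓡 n) a x)
        (mfderiv (𝓡 n) 𝓘(ℝ, EuclideanSpace ℝ (Fin n)) (extChartAt (𝓡 n) a) x v) := by
  have hx' : x ∈ (extChartAt (𝓡 n) a).source := by rwa [extChartAt_source]
  have hsymm : ContMDiffOn 𝓘(ℝ, EuclideanSpace ℝ (Fin n)) (𝓡 n) 1 (extChartAt (𝓡 n) a).symm
    (extChartAt (𝓡 n) a).target := contMDiffOn_extChartAt_symm a
  have h1 : MDifferentiableAt 𝓘(ℝ, EuclideanSpace ℝ (Fin n)) (𝓡 k)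
      (h ∘ (extChartAt (𝓡 n) a).symm) (extChartAt (𝓡 n) a x) :=
    ((hh.comp_contMDiffOn hsymm).contMDiffAt ((isOpen_extChartAt_target a).mem_nhds
      ((extChartAt (𝓡 n) a).map_source hx'))).mdifferentiableAt one_ne_zero
  have h2 : MDifferentiableAt (𝓡 n) 𝓘(ℝ, EuclideanSpace ℝ (Fin n)) (extChartAt (𝓡 n) a) x :=
    mdifferentiableAt_extChartAt hx
  have h3 : h =ᶠ[nhds x] (h ∘ (extChartAt (𝓡 n) a).symm) ∘ extChartAt (𝓡 n) a := by
    filter_upwards [(isOpen_extChartAt_source a).mem_nhds hx'] with y hy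
    exact congrArg h ((extChartAt (𝓡 n) a).left_inv hy).symm
  rw [h3.mfderiv_eq, mfderiv_comp x h1 h2, mfderiv_eq_fderiv]
  rfl

theorem ContMDiff.contDiffOn_comp_extChartAt_symm {n k : ℕ} {r : WithTop ℕ∞}
    {X : Type*} [TopologicalSpace X] [ChartedSpace (EuclideanSpace ℝ (Fin n)) X]
    [IsManifold (𝓡 n) r X] {h : X → EuclideanSpace ℝ (Fin k)} (hh : ContMDiff (𝓡 n) (𝓡 k) r h)
    (a : X) :
    ContDiffOn ℝ r (h ∘ (extChartAt (𝓡 n) a).symm) (extChartAt (𝓡 n) a).target :=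
  contMDiffOn_iff_contDiffOn.1 (hh.comp_contMDiffOn (contMDiffOn_extChartAt_symm a))

theorem dimH_matrixEntries_image_not_injective_le {n m l : ℕ}
    {X : Type*} [TopologicalSpace X] [CompactSpace X]
    [ChartedSpace (EuclideanSpace ℝ (Fin n)) X] [IsManifold (𝓡 n) 1 X]
    {f : X → EuclideanSpace ℝ (Fin m)} (hf : ContMDiff (𝓡 n) (𝓡 m) 1 f)
    (hinj : Function.Injective f)
    {G : X → EuclideanSpace ℝ (Fin l)} (hG : ContMDiff (𝓡 n) (𝓡 l) 1 G) :
    dimH (matrixEntries '' {p | ¬ Function.Injective fun x => G x + p (f x)}) ≤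
      (2 * n + l * (m - 1) : ℕ) := by
  let U (a : X) := (extChartAt (𝓡 n) a).target
  let S (a b : X) : Set (EuclideanSpace ℝ (Fin m) →ₗ[ℝ] EuclideanSpace ℝ (Fin l)) :=
    {p | ∃ z ∈ U a ×ˢ U b,
      f ((extChartAt (𝓡 n) a).symm z.1) - f ((extChartAt (𝓡 n) b).symm z.2) ≠ 0 ∧
      G ((extChartAt (𝓡 n) a).symm z.1) - G ((extChartAt (𝓡 n) b).symm z.2) +
        p (f ((extChartAt (𝓡 n) a).symm z.1) - f ((extChartAt (𝓡 n) b).symm z.2)) = 0}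
  have hS (a b : X) : dimH (matrixEntries '' S a b) ≤ (2 * n + l * (m - 1) : ℕ) := by
    have hrank : Module.finrank ℝ (EuclideanSpace ℝ (Fin n) × EuclideanSpace ℝ (Fin n)) =
        2 * n := by simp [two_mul]
    have hd {k : ℕ} {h : X → EuclideanSpace ℝ (Fin k)} (hh : ContMDiff (𝓡 n) (𝓡 k) 1 h) :
        ContDiffOn ℝ 1 (fun z : EuclideanSpace ℝ (Fin n) × EuclideanSpace ℝ (Fin n) =>
          h ((extChartAt (𝓡 n) a).symm z.1) - h ((extChartAt (𝓡 n) b).symm z.2))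
          (U a ×ˢ U b) :=
      ((hh.contDiffOn_comp_extChartAt_symm a).comp contDiff_fst.contDiffOn fun z hz => hz.1).sub
        ((hh.contDiffOn_comp_extChartAt_symm b).comp contDiff_snd.contDiffOn fun z hz => hz.2)
    rw [← hrank]
    exact dimH_matrixEntries_image_le
      ((isOpen_extChartAt_target a).prod (isOpen_extChartAt_target b)) (hd hf) (hd hG)
  obtain ⟨t, ht⟩ := CompactSpace.elim_nhds_subcover (fun a : X => (extChartAt (𝓡 n) a).source)
    fun a => extChartAt_source_mem_nhds a
  have hcover (x : X) : ∃ a ∈ t, x ∈ (extChartAt (𝓡 n) a).source := by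
    simpa using ht.ge (Set.mem_univ x)
  refine (dimH_mono (t := ⋃ a ∈ (t : Set X), ⋃ b ∈ (t : Set X), matrixEntries '' S a b) ?_).trans ?_
  · rintro _ ⟨p, hp, rfl⟩
    simp only [Set.mem_ofPred_eq, Function.Injective, not_forall] at hp
    obtain ⟨x, y, hxy, hne⟩ := hp
    obtain ⟨a, hat, ha⟩ := hcover x
    obtain ⟨b, hbt, hb⟩ := hcover y
    refine Set.mem_biUnion hat (Set.mem_biUnion hbt ⟨p,
      ⟨(extChartAt (𝓡 n) a x, extChartAt (𝓡 n) b y),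
        ⟨(extChartAt (𝓡 n) a).map_source ha, (extChartAt (𝓡 n) b).map_source hb⟩, ?_⟩, rfl⟩)
    rw [(extChartAt (𝓡 n) a).left_inv ha, (extChartAt (𝓡 n) b).left_inv hb]
    refine ⟨sub_ne_zero.2 fun h => hne (hinj h), ?_⟩
    rw [map_sub, sub_add_sub_comm, sub_eq_zero]
    exact hxy
  · rw [dimH_bUnion t.countable_toSet]
    refine iSup₂_le fun a _ => ?_
    rw [dimH_bUnion t.countable_toSet]
    exact iSup₂_le fun b _ => hS a b

/-- Class `C^2` is needed because the parametrization involves the first derivatives of `f` and `G`,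
which must be `C^1`. Kernel vectors need not be normalized: dimension `2n` suffices. -/
theorem dimH_matrixEntries_image_not_immersion_le {n m l : ℕ}
    {X : Type*} [TopologicalSpace X] [CompactSpace X]
    [ChartedSpace (EuclideanSpace ℝ (Fin n)) X] [IsManifold (𝓡 n) 2 X]
    {f : X → EuclideanSpace ℝ (Fin m)} (hf : ContMDiff (𝓡 n) (𝓡 m) 2 f)
    (himm : ∀ x, Function.Injective (mfderiv (𝓡 n) (𝓡 m) f x))
    {G : X → EuclideanSpace ℝ (Fin l)} (hG : ContMDiff (𝓡 n) (𝓡 l) 2 G) :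
    dimH (matrixEntries '' {p |
      ¬ ∀ x, Function.Injective (mfderiv (𝓡 n) (𝓡 l) (fun x => G x + p (f x)) x)}) ≤
      (2 * n + l * (m - 1) : ℕ) := by
  have : IsManifold (𝓡 n) 1 X := .of_le one_le_two
  let U (a : X) := (extChartAt (𝓡 n) a).target
  let S (a : X) : Set (EuclideanSpace ℝ (Fin m) →ₗ[ℝ] EuclideanSpace ℝ (Fin l)) :=
    {p | ∃ z ∈ U a ×ˢ (Set.univ : Set (EuclideanSpace ℝ (Fin n))),
      fderiv ℝ (f ∘ (extChartAt (𝓡 n) a).symm) z.1 z.2 ≠ 0 ∧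
      fderiv ℝ (G ∘ (extChartAt (𝓡 n) a).symm) z.1 z.2 +
        p (fderiv ℝ (f ∘ (extChartAt (𝓡 n) a).symm) z.1 z.2) = 0}
  have hS (a : X) : dimH (matrixEntries '' S a) ≤ (2 * n + l * (m - 1) : ℕ) := by
    have hrank : Module.finrank ℝ (EuclideanSpace ℝ (Fin n) × EuclideanSpace ℝ (Fin n)) =
        2 * n := by simp [two_mul]
    have hd {k : ℕ} {h : X → EuclideanSpace ℝ (Fin k)} (hh : ContMDiff (𝓡 n) (𝓡 k) 2 h) :
        ContDiffOn ℝ 1 (fun z : EuclideanSpace ℝ (Fin n) × EuclideanSpace ℝ (Fin n) =>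
          fderiv ℝ (h ∘ (extChartAt (𝓡 n) a).symm) z.1 z.2) (U a ×ˢ Set.univ) :=
      (((hh.contDiffOn_comp_extChartAt_symm a).fderiv_of_isOpen (isOpen_extChartAt_target a)
        one_add_one_eq_two.le).comp contDiff_fst.contDiffOn fun z hz => hz.1).clm_apply
          contDiff_snd.contDiffOn
    rw [← hrank]
    exact dimH_matrixEntries_image_le
      ((isOpen_extChartAt_target a).prod isOpen_univ) (hd hf) (hd hG)
  obtain ⟨t, ht⟩ := CompactSpace.elim_nhds_subcover (fun a : X => (extChartAt (𝓡 n) a).source)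
    fun a => extChartAt_source_mem_nhds a
  have hcover (x : X) : ∃ a ∈ t, x ∈ (extChartAt (𝓡 n) a).source := by
    simpa using ht.ge (Set.mem_univ x)
  refine (dimH_mono (t := ⋃ a ∈ (t : Set X), matrixEntries '' S a) ?_).trans ?_
  · rintro _ ⟨p, hp, rfl⟩
    simp only [Set.mem_ofPred_eq, not_forall] at hp
    obtain ⟨x, hx⟩ := hp
    obtain ⟨v, hv, hv0⟩ : ∃ v : TangentSpace (𝓡 n) x,
        mfderiv (𝓡 n) (𝓡 l) (fun x => G x + p (f x)) x v = 0 ∧ v ≠ 0 := by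
      by_contra! h
      exact hx ((injective_iff_map_eq_zero _).2 h)
    obtain ⟨a, hat, ha⟩ := hcover x
    have hz := (extChartAt (𝓡 n) a).map_source ha
    have ha' : x ∈ (chartAt (EuclideanSpace ℝ (Fin n)) a).source := by
      rwa [extChartAt_source] at ha
    refine Set.mem_biUnion hat ⟨p, ⟨(extChartAt (𝓡 n) a x,
      mfderiv (𝓡 n) 𝓘(ℝ, EuclideanSpace ℝ (Fin n)) (extChartAt (𝓡 n) a) x v),
        ⟨hz, trivial⟩, ?_, ?_⟩, rfl⟩
    -- Injectivity of the differential of `f` suffices here; that of the chart is not needed.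
    · intro h0
      refine hv0 ((injective_iff_map_eq_zero _).1 (himm x) v ?_)
      rw [mfderiv_apply_eq_fderiv_comp_extChartAt_symm (hf.of_le one_le_two) ha']
      exact h0
    · have hd {k : ℕ} {h : X → EuclideanSpace ℝ (Fin k)} (hh : ContMDiff (𝓡 n) (𝓡 k) 2 h) :
          DifferentiableAt ℝ (h ∘ (extChartAt (𝓡 n) a).symm) (extChartAt (𝓡 n) a x) :=
        ((hh.contDiffOn_comp_extChartAt_symm a).contDiffAt
          ((isOpen_extChartAt_target a).mem_nhds hz)).differentiableAt two_ne_zero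
      have hH : ContMDiff (𝓡 n) (𝓡 l) 1 fun x => G x + p (f x) :=
        (hG.of_le one_le_two).add
          (p.toContinuousLinearMap.contDiff.contMDiff.comp (hf.of_le one_le_two))
      have hderiv := ((hd hG).hasFDerivAt.add
        (p.toContinuousLinearMap.hasFDerivAt.comp _ (hd hf).hasFDerivAt)).fderiv
      rw [mfderiv_apply_eq_fderiv_comp_extChartAt_symm hH ha'] at hv
      exact (DFunLike.congr_fun hderiv _).symm.trans hv
  · rw [dimH_bUnion t.countable_toSet]
    exact iSup₂_le fun a _ => hS a

theorem corollary5p15 {n m l : ℕ} (r : ℕ∞) (hr : 2 ≤ r) (hl : 2 * n < l)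
    {X : Type*} [TopologicalSpace X] [T2Space X] [SecondCountableTopology X] [CompactSpace X]
    [ChartedSpace (EuclideanSpace ℝ (Fin n)) X] [IsManifold (𝓡 n) r X]
    (V : Set (EuclideanSpace ℝ (Fin m))) (hV : IsOpen V)
    (f : X → EuclideanSpace ℝ (Fin m)) (hf : IsCrEmbedding n r f) (hfV : ∀ x, f x ∈ V)
    (g : EuclideanSpace ℝ (Fin m) → EuclideanSpace ℝ (Fin l)) (hg : ContDiffOn ℝ r g V)
    (s : ℝ) (hs : (m : ℝ) * l + 2 * n - l < s) :
    HasHausdorffMeasureZero s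
      {p : EuclideanSpace ℝ (Fin m) →ₗ[ℝ] EuclideanSpace ℝ (Fin l) |
        ¬ IsCrEmbedding n r (fun x => g (f x) + p (f x))} := by
  have hr2 : (2 : WithTop ℕ∞) ≤ r := WithTop.coe_le_coe.2 hr
  have : IsManifold (𝓡 n) 2 X := .of_le hr2
  have : IsManifold (𝓡 n) 1 X := .of_le one_le_two
  have hG : ContMDiff (𝓡 n) (𝓡 l) r (fun x => g (f x)) := fun x =>
    ((hg.contDiffAt (hV.mem_nhds (hfV x))).contMDiffAt).comp x (hf.contMDiff x)
  have hH (p : EuclideanSpace ℝ (Fin m) →ₗ[ℝ] EuclideanSpace ℝ (Fin l)) :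
      ContMDiff (𝓡 n) (𝓡 l) r fun x => g (f x) + p (f x) :=
    hG.add (p.toContinuousLinearMap.contDiff.contMDiff.comp hf.contMDiff)
  have hsub : {p : EuclideanSpace ℝ (Fin m) →ₗ[ℝ] EuclideanSpace ℝ (Fin l) |
        ¬ IsCrEmbedding n r (fun x => g (f x) + p (f x))} ⊆
      {p | ¬ Function.Injective fun x => g (f x) + p (f x)} ∪
      {p | ¬ ∀ x, Function.Injective
        (mfderiv (𝓡 n) (𝓡 l) (fun x => g (f x) + p (f x)) x)} := by
    intro p hp
    by_contra hcon
    simp only [Set.mem_union, Set.mem_ofPred_eq, not_or, not_not] at hcon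
    exact hp ⟨hH p, hcon.2,
      ((hH p).continuous.isClosedEmbedding hcon.1).isEmbedding⟩
  -- For `m = 0` the truncated `m - 1` spoils the count, and `s` may be negative. But then `f`
  -- embeds `X` in a point, so `X` has at most one point and zero tangent spaces, and no `p` is bad.
  rcases Nat.eq_zero_or_pos m with rfl | hm
  · have hempty : {p : EuclideanSpace ℝ (Fin 0) →ₗ[ℝ] EuclideanSpace ℝ (Fin l) |
        ¬ IsCrEmbedding n r (fun x => g (f x) + p (f x))} = ∅ := by
      refine Set.eq_empty_of_subset_empty (hsub.trans ?_)
      rintro p (hp | hp)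
      · exact hp fun x y _ => hf.isEmbedding.injective (Subsingleton.elim _ _)
      · exact hp fun x v w _ => hf.injective_mfderiv x
          (Subsingleton.elim (α := EuclideanSpace ℝ (Fin 0)) _ _)
    simp [HasHausdorffMeasureZero, hempty]
  · have hcast : ((2 * n + l * (m - 1) : ℕ) : ℝ) = (m : ℝ) * l + 2 * n - l := by
      push_cast [Nat.cast_sub (Nat.one_le_iff_ne_zero.2 hm.ne')]
      ring
    rw [← hcast] at hs
    lift s to NNReal using (Nat.cast_nonneg _).trans hs.le
    refine hausdorffMeasure_of_dimH_lt (lt_of_le_of_lt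
      (b := ((2 * n + l * (m - 1) : ℕ) : ENNReal)) ?_ (by exact_mod_cast hs))
    refine (dimH_mono (Set.image_mono hsub)).trans ?_
    rw [Set.image_union, dimH_union]
    exact max_le
      (dimH_matrixEntries_image_not_injective_le (hf.contMDiff.of_le (one_le_two.trans hr2))
        hf.isEmbedding.injective (hG.of_le (one_le_two.trans hr2)))
      (dimH_matrixEntries_image_not_immersion_le (hf.contMDiff.of_le hr2)
        hf.injective_mfderiv (hG.of_le hr2))
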